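/- Let $A=(a_{ij})$ be an irreducible nonnegative $n\times n$ real matrix ($n\ge 1$) with nonzero row sums. Let $\rho(A)$ be its spectral radius and let $h$ be its index of imprimitivity, that is, the number of complex eigenvalues of $A$ of modulus $\rho(A)$. For a square matrix $B$ write $r_i(B)$ for its $i$-th row sum, and write $a^{(M)}_{ij}$ for the $(i,j)$ entry of $A^M$. Let $M>0$, $N\ge 0$, $k\ge 0$ be integers, put $r=\gcd(h,M+N)$, and let $$\mu_-=\min_{i,j:\;a^{(M)}_{ij}>0}\left(\frac{r_i(A^{k+M})\,r_j(A^{k+N})}{r_i(A^k)\,r_j(A^k)}\right)^{\frac1{M+N}},\qquad \mu_+=\max_{i,j:\;a^{(M)}_{ij}>0}\left(\frac{r_i(A^{k+M})\,r_j(A^{k+N})}{r_i(A^k)\,r_j(A^k)}\right)^{\frac1{M+N}}$$ be the lower and upper bounds for $\rho(A)$ whose sharpness is in question. The matrix $A^{M+N}$ is reducible if and only if $r>1$. Suppose that this is the case. Then the indices can be assigned to blocks by a surjective map $m:\{1,\dots,n\}\to\{1,\dots,r\}$ such that * $a_{ij}\ne0$ implies $m(j)=(m(i)\bmod r)+1$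 (up to a simultaneous permutation of rows and columns, $A$ has cyclic superdiagonal block form), and * $a^{(M+N)}_{ij}\neq 0$ implies $m(i)=m(j)$, and for each $\ell$ the diagonal block of $A^{M+N}$ on the indices $i$ with $m(i)=\ell$ is irreducible. For every such $m$, each of the two equalities $\rho(A)=\mu_-$ and $\rho(A)=\mu_+$ (and hence both) holds if and only if there are constants $c_1,\dots,c_r$ with $$\frac{r_i(A^{k+1})}{r_i(A^k)}=c_{m(i)}\qquad\text{for all } i\in\{1,\dots,n\}.$$ In that case $\rho(A)^r=\prod_{\ell=1}^r c_\ell$. -/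

import Mathlib

noncomputable section

/-- The `i`-th row sum `r_i(B)` of a real square matrix. -/
def rowSum {n : ℕ} (B : Matrix (Fin n) (Fin n) ℝ) (i : Fin n) : ℝ :=
  ∑ j, B i j

/-- A real matrix regarded as a complex matrix. -/
def complexify {n : ℕ} (A : Matrix (Fin n) (Fin n) ℝ) : Matrix (Fin n) (Fin n) ℂ :=
  A.map (fun x : ℝ => (x : ℂ))

/-- The spectral radius `ρ(A)`: the largest modulus of a complex eigenvalue. -/
def specRad {n : ℕ} (A : Matrix (Fin n) (Fin n) ℝ) : ℝ :=
  (spectralRadius ℂ (complexify A)).toReal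

/-- The number of complex eigenvalues of `A` of modulus `ρ(A)`; for an irreducible nonnegative
matrix this is the index of imprimitivity. (For such matrices these eigenvalues are simple, so
counting them with or without multiplicity is the same.) -/
def imprimitivityIndex {n : ℕ} (A : Matrix (Fin n) (Fin n) ℝ) : ℕ :=
  {μ : ℂ | μ ∈ spectrum ℂ (complexify A) ∧ ‖μ‖ = specRad A}.ncard

/-- The set of all numbers
`(r_i(A^(k+M)) r_j(A^(k+N)) / (r_i(A^k) r_j(A^k)))^(1/(M+N))` with `(A^M)_{ij} > 0`. -/
def boundValues {n : ℕ} (A : Matrix (Fin n) (Fin n) ℝ) (M N k : ℕ) : Set ℝ :=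
  {v | ∃ i j : Fin n, 0 < (A ^ M) i j ∧
    v = (rowSum (A ^ (k + M)) i * rowSum (A ^ (k + N)) j /
      (rowSum (A ^ k) i * rowSum (A ^ k) j)) ^ (1 / ((M + N : ℕ) : ℝ))}

/-- `m` assigns the rows of `A` to `r` nonempty blocks, numbered `0, …, r - 1`, such that grouping
the indices by blocks brings `A` to the cyclic superdiagonal block form (block `ℓ` only leads to
block `ℓ + 1` modulo `r`) and `A ^ L` to block diagonal form with irreducible diagonal blocks. -/
structure IsCyclicBlockMap {n : ℕ} (A : Matrix (Fin n) (Fin n) ℝ) (L r : ℕ)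
    (m : Fin n → Fin r) : Prop where
  surjective : Function.Surjective m
  superdiagonal : ∀ i j, A i j ≠ 0 → (m j : ℕ) = ((m i : ℕ) + 1) % r
  blockDiagonal : ∀ i j, (A ^ L) i j ≠ 0 → m i = m j
  irreducible_block : ∀ ℓ : Fin r,
    ((A ^ L).submatrix (Subtype.val : {i // m i = ℓ} → Fin n)
      (Subtype.val : {i // m i = ℓ} → Fin n)).IsIrreducible

end

/-!
Let `ρ` be the spectral radius of `A`, `h` its index of imprimitivity, `p = M + N`, `r = gcd h p`,
and let `x` be the vector of row sums of `A ^ k`.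

**Perron vectors.** Maximizing `t` subject to `t x ≤ A x` over the simplex, and using that a sum of
powers of `A` is positive, gives a positive eigenvector
(`Matrix.IsIrreducible.exists_pos_eigenvector`). Applied to `A` and its transpose this yields a
positive left eigenvector `y` for `ρ`.

**Cyclic structure.** By the equality case of the triangle inequality, an eigenvalue of modulus `ρ`
is `ρ w` with `w` in the group of numbers by which some nowhere zero function on the indices is
multiplied along every positive entry of `A`
(`Matrix.IsIrreducible.peripheral_spectrum_eq`). This group is finite of order `h`, so it consists
of the `h`-th roots of unity. Hence `h` divides the length of every closed walk, and every common
divisor of the lengths of closed walks through a vertex divides `h`. Modulo `p` these lengths form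
a group, so indices of equal phase modulo `r` are joined by walks whose length is a multiple of `p`
(`Matrix.IsIrreducible.exists_pow_pow_apply_pos`). The phase modulo `r` is therefore the required
block map, and `A ^ p` is irreducible exactly when `r = 1`.

**Sharpness.** The quotients `(A ^ M x) i * (A ^ N x) j / (x i * x j)` over the positive entries of
`A ^ M` have a weighted mean with positive weights, built from `y`, that equals `ρ ^ p`
(`Matrix.IsIrreducible.sum_weight_mul_sub_eq_zero`). So either bound is sharp only if all the
quotients equal `ρ ^ p`, and then `A ^ p x = ρ ^ p x`. Since `A x` is an eigenvector of `A ^ p` for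
the same eigenvalue, the maximum principle on the irreducible blocks makes `A x / x` constant on
each block. Conversely, if `A x / x` is `c ℓ` on block `ℓ`, then every quotient is a product of `p`
cyclically consecutive `c ℓ`, and `A ^ r x = (∏ ℓ, c ℓ) x` gives `ρ ^ r = ∏ ℓ, c ℓ`.
-/

/-! ### Powers of nonnegative irreducible matrices -/

namespace Matrix

lemma mulVec_pos_of_forall_pos {ι : Type*} [Fintype ι] {S : Matrix ι ι ℝ}
    (hS : ∀ i j, 0 < S i j) {v : ι → ℝ}
    (hv : ∀ i, 0 ≤ v i) (hv0 : v ≠ 0) (i : ι) : 0 < (S *ᵥ v) i := by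
  obtain ⟨j, hj⟩ := Function.ne_iff.1 hv0
  exact Finset.sum_pos' (fun a _ => mul_nonneg (hS i a).le (hv a))
    ⟨j, Finset.mem_univ _, mul_pos (hS i j) ((hv j).lt_of_ne (Ne.symm hj))⟩

variable {ι : Type*} [Fintype ι] [DecidableEq ι] {A : Matrix ι ι ℝ}

lemma pow_add_apply_pos (hA : ∀ i j, 0 ≤ A i j) {s t : ℕ} {i j l : ι}
    (hs : 0 < (A ^ s) i j) (ht : 0 < (A ^ t) j l) : 0 < (A ^ (s + t)) i l := by
  rw [pow_add, mul_apply]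
  exact Finset.sum_pos' (fun a _ => mul_nonneg (pow_apply_nonneg hA _ _ _)
    (pow_apply_nonneg hA _ _ _)) ⟨j, Finset.mem_univ _, mul_pos hs ht⟩

lemma pow_mul_apply_self_pos (hA : ∀ i j, 0 ≤ A i j) {t : ℕ} {i : ι}
    (ht : 0 < (A ^ t) i i) (q : ℕ) : 0 < (A ^ (q * t)) i i := by
  induction q with
  | zero => simp
  | succ q ih => rw [Nat.succ_mul]; exact pow_add_apply_pos hA ih ht

lemma exists_pos_of_pow_succ_apply_pos (hA : ∀ i j, 0 ≤ A i j) {t : ℕ} {i l : ι}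
    (h : 0 < (A ^ (t + 1)) i l) : ∃ j, 0 < A i j ∧ 0 < (A ^ t) j l := by
  rw [pow_succ', mul_apply] at h
  obtain ⟨j, -, hj⟩ := Finset.exists_lt_of_sum_lt (f := fun _ => (0 : ℝ)) (by simpa using h)
  refine ⟨j, (hA i j).lt_of_ne fun h0 => ?_, (pow_apply_nonneg hA t j l).lt_of_ne fun h0 => ?_⟩
  · simp [← h0] at hj
  · simp [← h0] at hj

lemma IsIrreducible.exists_pow_apply_pos (hA : A.IsIrreducible) (i j : ι) :
    ∃ t > 0, 0 < (A ^ t) i j :=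
  (isIrreducible_iff_exists_pow_pos hA.nonneg).1 hA i j

lemma IsIrreducible.exists_apply_pos (hA : A.IsIrreducible) (i : ι) : ∃ j, 0 < A i j := by
  obtain ⟨t, ht, h⟩ := hA.exists_pow_apply_pos i i
  obtain ⟨t, rfl⟩ : ∃ s, t = s + 1 := ⟨t - 1, by omega⟩
  obtain ⟨j, hj, -⟩ := exists_pos_of_pow_succ_apply_pos hA.nonneg h
  exact ⟨j, hj⟩

lemma IsIrreducible.exists_pow_apply_pos_of_length (hA : A.IsIrreducible) (t : ℕ) (i : ι) :
    ∃ j, 0 < (A ^ t) i j := by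
  induction t with
  | zero => exact ⟨i, by simp⟩
  | succ t ih =>
    obtain ⟨j, hj⟩ := ih
    obtain ⟨l, hl⟩ := hA.exists_apply_pos j
    exact ⟨l, pow_add_apply_pos hA.nonneg hj (by simpa using hl)⟩

/-- If `m` advances by one modulo `r` along every positive entry of `A`, then it advances by `t`
along every positive entry of `A ^ t`. -/
lemma modEq_add_of_pow_apply_pos (hA : ∀ i j, 0 ≤ A i j) {r : ℕ} {m : ι → ℕ}
    (hm : ∀ i j, 0 < A i j → m j ≡ m i + 1 [MOD r]) {t : ℕ} {i j : ι}
    (h : 0 < (A ^ t) i j) : m j ≡ m i + t [MOD r] := by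
  induction t generalizing i with
  | zero =>
    by_cases hij : i = j
    · subst hij; rfl
    · simp [one_apply_ne hij] at h
  | succ t ih =>
    obtain ⟨l, hl, hl'⟩ := exists_pos_of_pow_succ_apply_pos hA h
    have := (ih hl').trans ((hm _ _ hl).add_right t)
    rwa [add_assoc, add_comm 1 t] at this

/-- Summing enough powers of an irreducible matrix gives a positive matrix. -/
lemma IsIrreducible.exists_sum_pow_pos (hA : A.IsIrreducible) :
    ∃ K : ℕ, ∀ i j, 0 < (∑ t ∈ Finset.range K, A ^ t) i j := by
  choose T _ hT using hA.exists_pow_apply_pos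
  refine ⟨(Finset.univ.sup fun p : ι × ι => T p.1 p.2) + 1, fun i j => ?_⟩
  rw [sum_apply]
  refine Finset.sum_pos' (fun t _ => pow_apply_nonneg hA.nonneg t i j) ⟨T i j, ?_, hT i j⟩
  rw [Finset.mem_range, Nat.lt_succ_iff]
  exact Finset.le_sup (f := fun p : ι × ι => T p.1 p.2) (Finset.mem_univ (i, j))

lemma pow_mulVec_of_mulVec_eq_smul {R : Type*} [CommRing R] {A : Matrix ι ι R} {x : ι → R} {ρ : R}
    (h : A *ᵥ x = ρ • x) (t : ℕ) : (A ^ t) *ᵥ x = ρ ^ t • x := by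
  induction t with
  | zero => simp
  | succ t ih => rw [pow_succ, ← mulVec_mulVec, h, mulVec_smul, ih, smul_smul, pow_succ']

/-! ### The Perron vector -/

/-- The compact set of pairs `(t, x)` with `x` in the simplex and `t x ≤ A x` has a point with
largest `t`. -/
lemma exists_maximal_subinvariant [Nonempty ι] (hA : ∀ i j, 0 ≤ A i j) :
    ∃ ρ : ℝ, ∃ x ∈ stdSimplex ℝ ι, 0 ≤ ρ ∧ (∀ i, ρ * x i ≤ (A *ᵥ x) i) ∧
      ∀ t : ℝ, ∀ y ∈ stdSimplex ℝ ι, (∀ i, t * y i ≤ (A *ᵥ y) i) → t ≤ ρ := by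
  set C : ℝ := ∑ i, ∑ j, A i j
  have hC : ∀ t : ℝ, ∀ y ∈ stdSimplex ℝ ι, (∀ i, t * y i ≤ (A *ᵥ y) i) → t ≤ C := by
    intro t y hy h
    calc t = ∑ i, t * y i := by rw [← Finset.mul_sum, hy.2, mul_one]
      _ ≤ ∑ i, ∑ j, A i j * y j := Finset.sum_le_sum fun i _ => h i
      _ ≤ C := Finset.sum_le_sum fun i _ => Finset.sum_le_sum fun j _ =>
        mul_le_of_le_one_right (hA i j)
          ((Finset.single_le_sum (fun a _ => hy.1 a) (Finset.mem_univ j)).trans_eq hy.2)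
  have hC0 : 0 ≤ C := Finset.sum_nonneg fun i _ => Finset.sum_nonneg fun j _ => hA i j
  let K : Set (ℝ × (ι → ℝ)) :=
    (Set.Icc 0 C ×ˢ stdSimplex ℝ ι) ∩ {p | ∀ i, p.1 * p.2 i ≤ (A *ᵥ p.2) i}
  have hK : IsCompact K := by
    refine (isCompact_Icc.prod (isCompact_stdSimplex ℝ ι)).inter_right ?_
    simp only [Set.ofPred_forall, mulVec, dotProduct]
    exact isClosed_iInter fun i => isClosed_le (by fun_prop) (by fun_prop)
  obtain ⟨i₀⟩ := ‹Nonempty ι›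
  have hmem : Pi.single i₀ 1 ∈ stdSimplex ℝ ι := single_mem_stdSimplex ℝ i₀
  have hne : K.Nonempty := ⟨(0, Pi.single i₀ 1), ⟨⟨le_rfl, hC0⟩, hmem⟩, fun i => by
    rw [zero_mul]
    exact Finset.sum_nonneg fun j _ => mul_nonneg (hA i j) (hmem.1 j)⟩
  obtain ⟨⟨ρ, x⟩, ⟨⟨hρ, hx⟩, hle⟩, hmax⟩ := hK.exists_isMaxOn hne continuous_fst.continuousOn
  refine ⟨ρ, x, hx, hρ.1, hle, fun t y hy h => ?_⟩
  rcases le_total t 0 with ht | ht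
  · exact ht.trans hρ.1
  · exact hmax (show (t, y) ∈ K from ⟨⟨⟨ht, hC t y hy h⟩, hy⟩, h⟩)

/-- Existence part of the Perron–Frobenius theorem, by the Collatz–Wielandt extremal argument. -/
theorem IsIrreducible.exists_pos_eigenvector [Nonempty ι] (hA : A.IsIrreducible) :
    ∃ ρ : ℝ, 0 < ρ ∧ ∃ x : ι → ℝ, (∀ i, 0 < x i) ∧ A *ᵥ x = ρ • x := by
  obtain ⟨ρ, x, hx, hρ, hle, hmax⟩ := exists_maximal_subinvariant hA.nonneg
  obtain ⟨K, hK⟩ := hA.exists_sum_pow_pos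
  set S : Matrix ι ι ℝ := ∑ t ∈ Finset.range K, A ^ t
  have hcomm : A * S = S * A := by
    simp only [S, Finset.mul_sum, Finset.sum_mul, ← pow_succ, ← pow_succ']
  have hx0 : x ≠ 0 := by
    rintro rfl
    simpa using hx.2
  have hSx : ∀ i, 0 < (S *ᵥ x) i := mulVec_pos_of_forall_pos hK hx.1 hx0
  have heig : A *ᵥ x = ρ • x := by
    -- Otherwise `S x` satisfies the subinvariance inequality strictly, so `ρ` could be increased.
    by_contra hne
    have hstrict : ∀ i, ρ * (S *ᵥ x) i < (A *ᵥ (S *ᵥ x)) i := by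
      intro i
      have h := mulVec_pos_of_forall_pos hK (v := A *ᵥ x - ρ • x)
        (fun i => by simpa using hle i) (sub_ne_zero.2 hne) i
      rw [mulVec_sub, mulVec_smul, mulVec_mulVec, ← hcomm, ← mulVec_mulVec] at h
      simpa using h
    obtain ⟨i₁, hi₁⟩ := Finite.exists_min fun i => (A *ᵥ (S *ᵥ x)) i / (S *ᵥ x) i
    set t := (A *ᵥ (S *ᵥ x)) i₁ / (S *ᵥ x) i₁
    have ht : ρ < t := (lt_div_iff₀ (hSx i₁)).2 (hstrict i₁)
    have hsum : 0 < ∑ i, (S *ᵥ x) i := Finset.sum_pos (fun i _ => hSx i) Finset.univ_nonempty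
    refine absurd (hmax t ((∑ i, (S *ᵥ x) i)⁻¹ • (S *ᵥ x)) ⟨fun i => ?_, ?_⟩ fun i => ?_)
      ht.not_ge
    · exact mul_nonneg (inv_nonneg.2 hsum.le) (hSx i).le
    · simp only [Pi.smul_apply, smul_eq_mul, ← Finset.mul_sum]
      exact inv_mul_cancel₀ hsum.ne'
    · rw [mulVec_smul]
      simp only [Pi.smul_apply, smul_eq_mul]
      rw [mul_left_comm]
      exact mul_le_mul_of_nonneg_left ((le_div_iff₀ (hSx i)).1 (hi₁ i)) (inv_nonneg.2 hsum.le)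
  have hpow : S *ᵥ x = (∑ t ∈ Finset.range K, ρ ^ t) • x := by
    simp only [S, sum_mulVec, pow_mulVec_of_mulVec_eq_smul heig, Finset.sum_smul]
  have hxpos : ∀ i, 0 < x i := fun i => (hx.1 i).lt_of_ne fun h0 => by
    have h := hSx i
    rw [hpow] at h
    simp [← h0] at h
  refine ⟨ρ, hρ.lt_of_ne fun h0 => ?_, x, hxpos, heig⟩
  obtain ⟨i⟩ := ‹Nonempty ι›
  obtain ⟨j, hj⟩ := hA.exists_apply_pos i
  have h : 0 < (A *ᵥ x) i := Finset.sum_pos' (fun a _ => mul_nonneg (hA.nonneg i a) (hx.1 a))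
    ⟨j, Finset.mem_univ _, mul_pos hj (hxpos j)⟩
  simp [heig, ← h0] at h

/-- An irreducible matrix has positive right and left eigenvectors for the same eigenvalue. -/
theorem IsIrreducible.exists_pos_eigenvectors [Nonempty ι] (hA : A.IsIrreducible) :
    ∃ ρ : ℝ, 0 < ρ ∧ (∃ x : ι → ℝ, (∀ i, 0 < x i) ∧ A *ᵥ x = ρ • x) ∧
      ∃ y : ι → ℝ, (∀ i, 0 < y i) ∧ y ᵥ* A = ρ • y := by
  obtain ⟨ρ, hρ, x, hx, hAx⟩ := hA.exists_pos_eigenvector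
  obtain ⟨σ, -, y, hy, hAy⟩ := hA.transpose.exists_pos_eigenvector
  rw [mulVec_transpose] at hAy
  have hyx : 0 < y ⬝ᵥ x :=
    Finset.sum_pos (fun i _ => mul_pos (hy i) (hx i)) Finset.univ_nonempty
  have h := dotProduct_mulVec y A x
  rw [hAx, hAy, dotProduct_smul, smul_dotProduct, smul_eq_mul, smul_eq_mul] at h
  obtain rfl := mul_right_cancel₀ hyx.ne' h
  exact ⟨ρ, hρ, ⟨x, hx, hAx⟩, y, hy, hAy⟩

lemma dotProduct_pow_mulVec {y : ι → ℝ} {ρ : ℝ} (hy : y ᵥ* A = ρ • y) (t : ℕ) (v : ι → ℝ) :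
    y ⬝ᵥ ((A ^ t) *ᵥ v) = ρ ^ t * (y ⬝ᵥ v) := by
  induction t with
  | zero => simp
  | succ t ih =>
    rw [pow_succ', ← mulVec_mulVec, dotProduct_mulVec, hy, smul_dotProduct, ih, smul_eq_mul,
      pow_succ', mul_assoc]

end Matrix

/-! ### The peripheral spectrum -/

namespace Matrix

lemma mem_spectrum_iff_exists_mulVec {ι K : Type*} [Fintype ι] [DecidableEq ι] [Field K]
    {B : Matrix ι ι K} {μ : K} : μ ∈ spectrum K B ↔ ∃ z ≠ 0, B *ᵥ z = μ • z := by
  rw [spectrum.mem_iff, isUnit_iff_isUnit_det, isUnit_iff_ne_zero, not_not,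
    ← exists_mulVec_eq_zero_iff]
  simp only [sub_mulVec, sub_eq_zero, algebraMap_eq_diagonal, Pi.algebraMap_def,
    Algebra.algebraMap_self, RingHom.id_apply]
  refine exists_congr fun z => and_congr_right fun _ => ?_
  rw [eq_comm]
  have : (diagonal fun _ : ι => μ) *ᵥ z = μ • z := by ext i; simp [mulVec_diagonal]
  rw [this]

/-- The group of multipliers `w` for which there is a nowhere zero function on the indices that is
multiplied by `w` along every positive entry of `A`. For irreducible `A` these are the eigenvalues
of maximal modulus, divided by the spectral radius. -/
def multiplierGroup {ι : Type*} (A : Matrix ι ι ℝ) : Subgroup ℂˣ where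
  carrier := {w | ∃ z : ι → ℂˣ, ∀ i j, 0 < A i j → z j = w * z i}
  one_mem' := ⟨1, by simp⟩
  mul_mem' := by
    rintro a b ⟨z, hz⟩ ⟨z', hz'⟩
    exact ⟨z * z', fun i j h => by
      rw [Pi.mul_apply, Pi.mul_apply, hz i j h, hz' i j h, mul_mul_mul_comm]⟩
  inv_mem' := by
    rintro a ⟨z, hz⟩
    exact ⟨z⁻¹, fun i j h => by rw [Pi.inv_apply, Pi.inv_apply, hz i j h, mul_inv]⟩

/-- A nonnegative subinvariant vector is an eigenvector, since the positive left eigenvector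
annihilates the defect. -/
lemma mulVec_eq_smul_of_le {ι : Type*} [Fintype ι] {A : Matrix ι ι ℝ} {y : ι → ℝ} {ρ : ℝ}
    (hy : ∀ i, 0 < y i) (hyA : y ᵥ* A = ρ • y)
    {u : ι → ℝ} (hu : ∀ i, ρ * u i ≤ (A *ᵥ u) i) : A *ᵥ u = ρ • u := by
  have h : ∑ i, y i * ((A *ᵥ u) i - ρ * u i) = 0 := by
    have := dotProduct_mulVec y A u
    rw [hyA, smul_dotProduct] at this
    simp only [dotProduct, smul_eq_mul, Finset.mul_sum] at this
    simp only [mul_sub, Finset.sum_sub_distrib, sub_eq_zero]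
    rw [this]
    exact Finset.sum_congr rfl fun i _ => by ring
  rw [Finset.sum_eq_zero_iff_of_nonneg
    fun i _ => mul_nonneg (hy i).le (sub_nonneg.2 (hu i))] at h
  ext i
  have := h i (Finset.mem_univ i)
  rw [mul_eq_zero, or_iff_right (hy i).ne', sub_eq_zero] at this
  simpa using this

section

variable {ι : Type*} [Fintype ι] [DecidableEq ι] {A : Matrix ι ι ℝ}

lemma eq_pow_mul_of_pow_apply_pos (hA : ∀ i j, 0 ≤ A i j) {w : ℂˣ} {z : ι → ℂˣ}
    (hz : ∀ i j, 0 < A i j → z j = w * z i) {t : ℕ} {i j : ι} (h : 0 < (A ^ t) i j) :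
    z j = w ^ t * z i := by
  induction t generalizing i with
  | zero =>
    by_cases hij : i = j
    · subst hij; simp
    · simp [one_apply_ne hij] at h
  | succ t ih =>
    obtain ⟨l, hl, hl'⟩ := exists_pos_of_pow_succ_apply_pos hA h
    rw [ih hl', hz _ _ hl, pow_succ, mul_assoc]

lemma pow_eq_one_of_mem_multiplierGroup (hA : ∀ i j, 0 ≤ A i j) {w : ℂˣ}
    (hw : w ∈ multiplierGroup A) {t : ℕ} {i : ι} (h : 0 < (A ^ t) i i) : w ^ t = 1 := by
  obtain ⟨z, hz⟩ := hw
  exact mul_eq_right.1 (eq_pow_mul_of_pow_apply_pos hA hz h).symm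

lemma IsIrreducible.norm_eq_one_of_mem_multiplierGroup [Nonempty ι] (hA : A.IsIrreducible)
    {w : ℂˣ} (hw : w ∈ multiplierGroup A) : ‖(w : ℂ)‖ = 1 := by
  obtain ⟨i⟩ := ‹Nonempty ι›
  obtain ⟨t, ht, h⟩ := hA.exists_pow_apply_pos i i
  have := pow_eq_one_of_mem_multiplierGroup hA.nonneg hw h
  exact Complex.norm_eq_one_of_pow_eq_one
    (by rw [← Units.val_pow_eq_pow_val, this, Units.val_one]) ht.ne'

end

variable {n : ℕ} {A : Matrix (Fin n) (Fin n) ℝ}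

lemma complexify_mulVec_apply (A : Matrix (Fin n) (Fin n) ℝ) (z : Fin n → ℂ) (i : Fin n) :
    (complexify A *ᵥ z) i = ∑ j, (A i j : ℂ) * z j := rfl

lemma norm_eigenvalue_mul_le (hA : ∀ i j, 0 ≤ A i j) {z : Fin n → ℂ} {μ : ℂ}
    (hz : complexify A *ᵥ z = μ • z) (i : Fin n) :
    ‖μ‖ * ‖z i‖ ≤ (A *ᵥ fun j => ‖z j‖) i := by
  have h := congrFun hz i
  rw [complexify_mulVec_apply, Pi.smul_apply, smul_eq_mul] at h
  rw [← norm_mul, ← h]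
  refine (norm_sum_le _ _).trans_eq (Finset.sum_congr rfl fun j _ => ?_)
  rw [norm_mul, Complex.norm_real, Real.norm_of_nonneg (hA i j)]

lemma norm_eigenvalue_le (hA : ∀ i j, 0 ≤ A i j) {y : Fin n → ℝ} {ρ : ℝ} (hy : ∀ i, 0 < y i)
    (hyA : y ᵥ* A = ρ • y) {μ : ℂ} (hμ : μ ∈ spectrum ℂ (complexify A)) : ‖μ‖ ≤ ρ := by
  obtain ⟨z, hz0, hz⟩ := mem_spectrum_iff_exists_mulVec.1 hμ
  obtain ⟨i, hi⟩ := Function.ne_iff.1 hz0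
  have hpos : 0 < y ⬝ᵥ fun j => ‖z j‖ :=
    Finset.sum_pos' (fun j _ => mul_nonneg (hy j).le (norm_nonneg _))
      ⟨i, Finset.mem_univ _, mul_pos (hy i) (norm_pos_iff.2 hi)⟩
  have h := dotProduct_mulVec y A fun j => ‖z j‖
  rw [hyA, smul_dotProduct, smul_eq_mul] at h
  refine le_of_mul_le_mul_right ?_ hpos
  rw [← h, dotProduct, dotProduct, Finset.mul_sum]
  refine Finset.sum_le_sum fun j _ => ?_
  rw [mul_left_comm]
  exact mul_le_mul_of_nonneg_left (norm_eigenvalue_mul_le hA hz j) (hy j).le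

/-- The eigenvalue of a positive right eigenvector is the spectral radius. -/
lemma specRad_eq_of_eigenvectors [NeZero n] (hA : ∀ i j, 0 ≤ A i j) {x y : Fin n → ℝ} {ρ : ℝ}
    (hρ : 0 < ρ) (hx : ∀ i, 0 < x i) (hAx : A *ᵥ x = ρ • x) (hy : ∀ i, 0 < y i)
    (hyA : y ᵥ* A = ρ • y) : specRad A = ρ := by
  have hmem : (ρ : ℂ) ∈ spectrum ℂ (complexify A) := by
    refine mem_spectrum_iff_exists_mulVec.2 ⟨fun i => (x i : ℂ), fun h => ?_, ?_⟩
    · have := congrFun h 0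
      simp only [Pi.zero_apply, Complex.ofReal_eq_zero] at this
      exact (hx 0).ne' this
    · ext i
      have := congrFun hAx i
      rw [complexify_mulVec_apply, Pi.smul_apply, smul_eq_mul, ← Complex.ofReal_mul]
      rw [Pi.smul_apply, smul_eq_mul] at this
      rw [← this, mulVec, dotProduct]
      push_cast
      rfl
  have h : spectralRadius ℂ (complexify A) = ENNReal.ofReal ρ := by
    refine le_antisymm (iSup₂_le fun μ hμ => ?_) ?_
    · rw [← enorm_eq_nnnorm, ← ofReal_norm]
      exact ENNReal.ofReal_le_ofReal (norm_eigenvalue_le hA hy hyA hμ)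
    · refine le_trans (le_of_eq ?_) (le_iSup₂ (f := fun μ (_ : μ ∈ spectrum ℂ (complexify A)) =>
        (‖μ‖₊ : ENNReal)) (ρ : ℂ) hmem)
      rw [← enorm_eq_nnnorm, ← ofReal_norm, Complex.norm_real,
        Real.norm_of_nonneg hρ.le]
  rw [specRad, h, ENNReal.toReal_ofReal hρ.le]

/-- The common eigenvalue of the positive right and left eigenvectors is the spectral radius. -/
lemma IsIrreducible.exists_specRad_eigenvectors [NeZero n] (hA : A.IsIrreducible) :
    0 < specRad A ∧ (∃ x : Fin n → ℝ, (∀ i, 0 < x i) ∧ A *ᵥ x = specRad A • x) ∧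
      ∃ y : Fin n → ℝ, (∀ i, 0 < y i) ∧ y ᵥ* A = specRad A • y := by
  obtain ⟨ρ, hρ, ⟨x, hx, hAx⟩, y, hy, hyA⟩ := hA.exists_pos_eigenvectors
  rw [specRad_eq_of_eigenvectors hA.nonneg hρ hx hAx hy hyA]
  exact ⟨hρ, ⟨x, hx, hAx⟩, y, hy, hyA⟩

/-- The equality case of the triangle inequality for a sum with nonnegative weights. -/
lemma _root_.Complex.norm_mul_eq_of_norm_sum_eq {ι : Type*} [Fintype ι] {a : ι → ℝ}
    (ha : ∀ j, 0 ≤ a j) {z : ι → ℂ} (h : ‖∑ j, (a j : ℂ) * z j‖ = ∑ j, a j * ‖z j‖) {j : ι}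
    (hj : 0 < a j) :
    (‖∑ j, (a j : ℂ) * z j‖ : ℂ) * z j = ‖z j‖ * ∑ j, (a j : ℂ) * z j := by
  set s : ℂ := ∑ j, (a j : ℂ) * z j with hs
  by_cases hs0 : s = 0
  · simp [hs0]
  have hre : ∀ k, (starRingEnd ℂ s * z k).re ≤ ‖s‖ * ‖z k‖ := fun k =>
    (Complex.re_le_norm _).trans_eq (by rw [norm_mul, Complex.norm_conj])
  have hsum : ∑ k, a k * (‖s‖ * ‖z k‖ - (starRingEnd ℂ s * z k).re) = 0 := by
    have h1 : ∑ k, a k * (starRingEnd ℂ s * z k).re = ‖s‖ * ‖s‖ := by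
      have : (starRingEnd ℂ s * s).re = ‖s‖ * ‖s‖ := by
        rw [mul_comm, Complex.mul_conj, Complex.ofReal_re, Complex.normSq_eq_norm_sq, sq]
      rw [← this]
      conv_rhs => rw [hs, Finset.mul_sum, Complex.re_sum]
      refine Finset.sum_congr rfl fun k _ => ?_
      rw [mul_left_comm, Complex.re_ofReal_mul]
    have h2 : ∑ k, a k * (‖s‖ * ‖z k‖) = ‖s‖ * ‖s‖ := by
      conv_rhs => rw [h, Finset.mul_sum, ← h]
      exact Finset.sum_congr rfl fun k _ => by ring
    simp only [mul_sub, Finset.sum_sub_distrib, h1, h2, sub_self]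
  rw [Finset.sum_eq_zero_iff_of_nonneg
    fun k _ => mul_nonneg (ha k) (sub_nonneg.2 (hre k))] at hsum
  have hk := hsum j (Finset.mem_univ j)
  rw [mul_eq_zero, or_iff_right hj.ne', sub_eq_zero] at hk
  have hval : starRingEnd ℂ s * z j = ((‖s‖ * ‖z j‖ : ℝ) : ℂ) := by
    have hn : ‖starRingEnd ℂ s * z j‖ = (starRingEnd ℂ s * z j).re := by
      rw [← hk, norm_mul, Complex.norm_conj]
    have h0 := Complex.re_eq_norm.1 hn.symm
    rw [Complex.eq_coe_norm_of_nonneg h0, norm_mul, Complex.norm_conj]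
  have hmul : s * starRingEnd ℂ s = (‖s‖ : ℂ) * ‖s‖ := by
    rw [Complex.mul_conj, Complex.normSq_eq_norm_sq]
    push_cast
    ring
  have hs0' : (‖s‖ : ℂ) ≠ 0 := by simpa using hs0
  refine mul_left_cancel₀ hs0' ?_
  rw [← mul_assoc, ← hmul, mul_assoc, hval]
  push_cast
  ring

/-- The eigenvalues of maximal modulus are the spectral radius times the multipliers. -/
theorem IsIrreducible.peripheral_spectrum_eq [NeZero n] (hA : A.IsIrreducible) :
    {μ : ℂ | μ ∈ spectrum ℂ (complexify A) ∧ ‖μ‖ = specRad A} =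
      (fun w : ℂˣ => (specRad A : ℂ) * w) '' multiplierGroup A := by
  obtain ⟨hρ, ⟨x, hx, hAx⟩, y, hy, hyA⟩ := hA.exists_specRad_eigenvectors
  set ρ := specRad A
  have hρC : (ρ : ℂ) ≠ 0 := Complex.ofReal_ne_zero.2 hρ.ne'
  ext μ
  constructor
  · rintro ⟨hμ, hnorm⟩
    obtain ⟨z, hz0, hz⟩ := mem_spectrum_iff_exists_mulVec.1 hμ
    have hμ0 : μ ≠ 0 := norm_ne_zero_iff.1 (hnorm.trans_ne hρ.ne')
    -- The moduli of the entries of `z` form a Perron vector, so none of them vanishes.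
    have hmod : A *ᵥ (fun j => ‖z j‖) = ρ • fun j => ‖z j‖ :=
      mulVec_eq_smul_of_le hy hyA fun i => hnorm ▸ norm_eigenvalue_mul_le hA.nonneg hz i
    have hne : ∀ i, z i ≠ 0 := by
      intro i hi
      obtain ⟨j, hj⟩ := Function.ne_iff.1 hz0
      obtain ⟨t, -, ht⟩ := hA.exists_pow_apply_pos i j
      have h := congrFun (pow_mulVec_of_mulVec_eq_smul hmod t) i
      have hpos : 0 < ((A ^ t) *ᵥ fun j => ‖z j‖) i := Finset.sum_pos'
        (fun a _ => mul_nonneg (pow_apply_nonneg hA.nonneg t i a) (norm_nonneg _))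
        ⟨j, Finset.mem_univ _, mul_pos ht (norm_pos_iff.2 hj)⟩
      simp [h, hi] at hpos
    have hnC : ∀ i, (‖z i‖ : ℂ) ≠ 0 := fun i => by simpa using hne i
    refine ⟨Units.mk0 (μ / ρ) (div_ne_zero hμ0 hρC),
      ⟨fun i => Units.mk0 (z i / ‖z i‖) (div_ne_zero (hne i) (hnC i)), fun i j hij => ?_⟩, ?_⟩
    · have hi : ∑ j, (A i j : ℂ) * z j = μ * z i := congrFun hz i
      have heq : ‖∑ j, (A i j : ℂ) * z j‖ = ∑ j, A i j * ‖z j‖ := by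
        rw [hi, norm_mul, hnorm]
        exact (congrFun hmod i).symm
      have h := Complex.norm_mul_eq_of_norm_sum_eq (hA.nonneg i) heq hij
      rw [hi, norm_mul, hnorm] at h
      ext
      simp only [Units.val_mk0, Units.val_mul]
      have := hnC i
      have := hnC j
      push_cast at h
      field_simp
      linear_combination h
    · simp only [Units.val_mk0]
      field_simp
  · rintro ⟨w, hw, rfl⟩
    have hnorm := hA.norm_eq_one_of_mem_multiplierGroup hw
    obtain ⟨z, hz⟩ := hw
    refine ⟨mem_spectrum_iff_exists_mulVec.2 ⟨fun i => x i * z i, fun h => ?_, ?_⟩, ?_⟩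
    · have := congrFun h 0
      simp [(hx 0).ne'] at this
    · ext i
      have hi : ∑ j, (A i j : ℂ) * x j = ρ * x i := by
        exact_mod_cast congrFun hAx i
      rw [complexify_mulVec_apply]
      calc ∑ j, (A i j : ℂ) * (x j * z j) = ∑ j, ((A i j : ℂ) * x j) * (w * z i) := by
            refine Finset.sum_congr rfl fun j _ => ?_
            rcases (hA.nonneg i j).eq_or_lt with h0 | h0
            · simp [← h0]
            · rw [hz i j h0, Units.val_mul]; ring
        _ = _ := by
          rw [← Finset.sum_mul, hi]
          simp only [Pi.smul_apply, smul_eq_mul]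
          ring
    · simp [hnorm, abs_of_pos hρ]

lemma IsIrreducible.imprimitivityIndex_eq [NeZero n] (hA : A.IsIrreducible) :
    imprimitivityIndex A = Nat.card (multiplierGroup A) := by
  have hρ := hA.exists_specRad_eigenvectors.1
  rw [imprimitivityIndex, hA.peripheral_spectrum_eq, Set.ncard_image_of_injective,
    ← Nat.card_coe_set_eq]
  · rfl
  · intro a b hab
    exact Units.ext (mul_left_cancel₀ (Complex.ofReal_ne_zero.2 hρ.ne') hab)

lemma IsIrreducible.finite_multiplierGroup [NeZero n] (hA : A.IsIrreducible) :
    Finite (multiplierGroup A) := by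
  have hρ := hA.exists_specRad_eigenvectors.1
  have hfin : ((fun w : ℂˣ => (specRad A : ℂ) * w) '' multiplierGroup A).Finite := by
    rw [← hA.peripheral_spectrum_eq]
    exact (finite_spectrum _).subset fun μ h => h.1
  refine Set.Finite.of_finite_image hfin (Function.Injective.injOn fun a b hab => ?_)
  exact Units.ext (mul_left_cancel₀ (Complex.ofReal_ne_zero.2 hρ.ne') hab)

lemma IsIrreducible.imprimitivityIndex_pos [NeZero n] (hA : A.IsIrreducible) :
    0 < imprimitivityIndex A := by
  have := hA.finite_multiplierGroup
  rw [hA.imprimitivityIndex_eq]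
  exact Nat.card_pos

/-- A finite subgroup of `ℂˣ` consists of all roots of unity of its order. -/
lemma IsIrreducible.multiplierGroup_eq_rootsOfUnity [NeZero n] (hA : A.IsIrreducible) :
    multiplierGroup A = rootsOfUnity (imprimitivityIndex A) ℂ := by
  have := hA.finite_multiplierGroup
  have : NeZero (imprimitivityIndex A) := ⟨hA.imprimitivityIndex_pos.ne'⟩
  refine Subgroup.eq_of_le_of_card_ge (fun w hw => ?_) ?_
  · rw [mem_rootsOfUnity, hA.imprimitivityIndex_eq]
    exact congrArg Subtype.val (pow_card_eq_one' (x := (⟨w, hw⟩ : multiplierGroup A)))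
  · rw [Complex.card_rootsOfUnity, hA.imprimitivityIndex_eq]

end Matrix

/-! ### Closed walks and the cyclic block structure -/

namespace Matrix

lemma exists_units_isPrimitiveRoot {d : ℕ} (hd : d ≠ 0) : ∃ ζ : ℂˣ, IsPrimitiveRoot ζ d := by
  have h := Complex.isPrimitiveRoot_exp d hd
  exact ⟨(h.isUnit hd).unit, h.isUnit_unit hd⟩

variable {n : ℕ} [NeZero n] {A : Matrix (Fin n) (Fin n) ℝ}

lemma IsIrreducible.imprimitivityIndex_dvd (hA : A.IsIrreducible) {t : ℕ} {i : Fin n}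
    (h : 0 < (A ^ t) i i) : imprimitivityIndex A ∣ t := by
  obtain ⟨ζ, hζ⟩ := exists_units_isPrimitiveRoot hA.imprimitivityIndex_pos.ne'
  refine (hζ.pow_eq_one_iff_dvd t).1 (pow_eq_one_of_mem_multiplierGroup hA.nonneg ?_ h)
  rw [hA.multiplierGroup_eq_rootsOfUnity, mem_rootsOfUnity]
  exact hζ.pow_eq_one

/-- If `d` divides the length of every closed walk through `i₀`, then the walk lengths from `i₀`,
read as exponents of a primitive `d`-th root of unity, exhibit that root as a multiplier. -/
lemma IsIrreducible.dvd_imprimitivityIndex (hA : A.IsIrreducible) {d : ℕ} (hd : d ≠ 0)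
    {i₀ : Fin n} (h : ∀ t, 0 < (A ^ t) i₀ i₀ → d ∣ t) : d ∣ imprimitivityIndex A := by
  obtain ⟨ζ, hζ⟩ := exists_units_isPrimitiveRoot hd
  choose a _ ha using hA.exists_pow_apply_pos i₀
  choose b _ hb using fun j => hA.exists_pow_apply_pos j i₀
  have hmem : ζ ∈ multiplierGroup A := by
    refine ⟨fun i => ζ ^ a i, fun i j hij => ?_⟩
    have h1 : ζ ^ (a j + b j) = 1 :=
      (hζ.pow_eq_one_iff_dvd _).2 (h _ (pow_add_apply_pos hA.nonneg (ha j) (hb j)))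
    have h2 : ζ ^ (a i + 1 + b j) = 1 := (hζ.pow_eq_one_iff_dvd _).2
      (h _ (pow_add_apply_pos hA.nonneg (pow_add_apply_pos hA.nonneg (ha i) (by simpa using hij))
        (hb j)))
    rw [← pow_succ']
    exact mul_right_cancel (b := ζ ^ b j) (by rw [← pow_add, ← pow_add, h1, h2])
  rw [hA.imprimitivityIndex_eq, hζ.eq_orderOf]
  exact Subgroup.orderOf_dvd_natCard _ hmem

lemma IsIrreducible.imprimitivityIndex_mem_closure (hA : A.IsIrreducible) (i₀ : Fin n) :
    (imprimitivityIndex A : ℤ) ∈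
      AddSubgroup.closure {e : ℤ | ∃ t : ℕ, 0 < (A ^ t) i₀ i₀ ∧ (t : ℤ) = e} := by
  obtain ⟨d, hd⟩ := Int.subgroup_cyclic
    (AddSubgroup.closure {e : ℤ | ∃ t : ℕ, 0 < (A ^ t) i₀ i₀ ∧ (t : ℤ) = e})
  rw [← AddSubgroup.zmultiples_eq_closure] at hd
  have hdvd : ∀ t : ℕ, 0 < (A ^ t) i₀ i₀ → d.natAbs ∣ t := by
    intro t ht
    have : (t : ℤ) ∈ AddSubgroup.zmultiples d := hd ▸ AddSubgroup.subset_closure ⟨t, ht, rfl⟩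
    exact Int.natAbs_dvd_natAbs.2 (Int.mem_zmultiples_iff.1 this)
  obtain ⟨t, ht, htpos⟩ := hA.exists_pow_apply_pos i₀ i₀
  have hd0 : d.natAbs ≠ 0 := fun h0 => ht.ne' (by simpa [h0] using hdvd t htpos)
  rw [hd, Int.mem_zmultiples_iff]
  exact Int.natAbs_dvd.1 (Int.natCast_dvd_natCast.2 (hA.dvd_imprimitivityIndex hd0 hdvd))

/-- Modulo a positive number, the lengths of closed walks through a vertex form a group, because
repeating a walk `p - 1` times negates its length modulo `p`. -/
lemma exists_pow_self_pos_modEq {ι : Type*} [Fintype ι] [DecidableEq ι] {A : Matrix ι ι ℝ}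
    (hA : ∀ i j, 0 ≤ A i j) {p : ℕ} (hp : 0 < p) {i₀ : ι} {e : ℤ}
    (he : e ∈ AddSubgroup.closure {e : ℤ | ∃ t : ℕ, 0 < (A ^ t) i₀ i₀ ∧ (t : ℤ) = e}) :
    ∃ t : ℕ, 0 < (A ^ t) i₀ i₀ ∧ (t : ℤ) ≡ e [ZMOD p] := by
  induction he using AddSubgroup.closure_induction with
  | mem e he =>
    obtain ⟨t, ht, rfl⟩ := he
    exact ⟨t, ht, rfl⟩
  | zero => exact ⟨0, by simp, rfl⟩
  | add x y _ _ hx hy =>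
    obtain ⟨s, hs, hs'⟩ := hx
    obtain ⟨t, ht, ht'⟩ := hy
    exact ⟨s + t, pow_add_apply_pos hA hs ht, by push_cast; exact hs'.add ht'⟩
  | neg x _ hx =>
    obtain ⟨s, hs, hs'⟩ := hx
    refine ⟨(p - 1) * s, pow_mul_apply_self_pos hA hs _, ?_⟩
    refine Int.ModEq.trans ?_ hs'.neg
    rw [Int.modEq_iff_dvd]
    refine ⟨-s, ?_⟩
    push_cast [Nat.cast_sub (show 1 ≤ p from hp)]
    ring

/-- Walk lengths from a base point give a function that advances by one modulo the index of
imprimitivity along every positive entry. -/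
lemma IsIrreducible.exists_phase (hA : A.IsIrreducible) :
    ∃ τ : Fin n → ℕ, ∀ i j, 0 < A i j → τ j ≡ τ i + 1 [MOD imprimitivityIndex A] := by
  choose a _ ha using hA.exists_pow_apply_pos 0
  choose b _ hb using fun j => hA.exists_pow_apply_pos j 0
  refine ⟨a, fun i j hij => Nat.ModEq.add_right_cancel' (b j) ?_⟩
  exact ((Nat.modEq_zero_iff_dvd.2 (hA.imprimitivityIndex_dvd
      (pow_add_apply_pos hA.nonneg (ha j) (hb j))))).trans
    (Nat.modEq_zero_iff_dvd.2 (hA.imprimitivityIndex_dvd (pow_add_apply_pos hA.nonneg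
      (pow_add_apply_pos hA.nonneg (ha i) (by simpa using hij)) (hb j)))).symm

/-- Two indices of equal phase modulo `gcd h p`, where `h` is the index of imprimitivity, are
joined by a walk whose length is a multiple of `p`: a walk through the base point can be corrected
there by closed walks of any length in `h ℤ + p ℤ`. -/
theorem IsIrreducible.exists_pow_pow_apply_pos (hA : A.IsIrreducible) {p : ℕ} (hp : 0 < p)
    {τ : Fin n → ℕ}
    (hτ : ∀ i j, 0 < A i j → τ j ≡ τ i + 1 [MOD Nat.gcd (imprimitivityIndex A) p])
    {i j : Fin n} (hij : τ i ≡ τ j [MOD Nat.gcd (imprimitivityIndex A) p]) :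
    ∃ t > 0, 0 < ((A ^ p) ^ t) i j := by
  set h := imprimitivityIndex A
  obtain ⟨b, hb0, hb⟩ := hA.exists_pow_apply_pos i 0
  obtain ⟨c, -, hc⟩ := hA.exists_pow_apply_pos 0 j
  have hmod := modEq_add_of_pow_apply_pos hA.nonneg hτ (pow_add_apply_pos hA.nonneg hb hc)
  have hdvd : Nat.gcd h p ∣ b + c := Nat.modEq_zero_iff_dvd.1
    (Nat.ModEq.add_left_cancel' (τ i) (hmod.symm.trans hij.symm))
  obtain ⟨q, hq⟩ := hdvd
  have hmem := AddSubgroup.zsmul_mem _ (hA.imprimitivityIndex_mem_closure 0)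
    (-(Nat.gcdA h p * q))
  obtain ⟨s, hs, hs'⟩ := exists_pow_self_pos_modEq hA.nonneg hp hmem
  have hpos := pow_add_apply_pos hA.nonneg (pow_add_apply_pos hA.nonneg hb hs) hc
  have hp' : p ∣ b + s + c := by
    obtain ⟨u, hu⟩ := Int.modEq_iff_dvd.1 hs'
    have hq' : (b : ℤ) + c = (h * Nat.gcdA h p + p * Nat.gcdB h p) * q := by
      rw [← Nat.gcd_eq_gcd_ab]
      exact_mod_cast hq
    rw [← Int.natCast_dvd_natCast]
    refine ⟨Nat.gcdB h p * q - u, ?_⟩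
    rw [smul_eq_mul] at hu
    push_cast
    linear_combination hq' - hu
  obtain ⟨t, ht⟩ := hp'
  refine ⟨t, Nat.pos_of_ne_zero fun h0 => ?_, ?_⟩
  · rw [h0, mul_zero] at ht
    omega
  · rwa [← pow_mul, ← ht]

lemma eq_of_pow_apply_ne_zero {ι κ : Type*} [Fintype ι] [DecidableEq ι] {B : Matrix ι ι ℝ}
    {m : ι → κ} (hB : ∀ i j, B i j ≠ 0 → m i = m j) {t : ℕ} {i j : ι} (h : (B ^ t) i j ≠ 0) :
    m i = m j := by
  induction t generalizing i with
  | zero =>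
    by_cases hij : i = j
    · rw [hij]
    · exact absurd (one_apply_ne hij) h
  | succ t ih =>
    rw [pow_succ', mul_apply] at h
    obtain ⟨l, -, hl⟩ := Finset.exists_ne_zero_of_sum_ne_zero h
    exact (hB i l (left_ne_zero_of_mul hl)).trans (ih (right_ne_zero_of_mul hl))

lemma submatrix_pow_of_blockDiagonal {ι κ : Type*} [Fintype ι] [DecidableEq ι] [DecidableEq κ]
    {B : Matrix ι ι ℝ} {m : ι → κ} (hB : ∀ i j, B i j ≠ 0 → m i = m j) (ℓ : κ) (t : ℕ) :
    (B.submatrix (Subtype.val : {i // m i = ℓ} → ι) (Subtype.val : {i // m i = ℓ} → ι)) ^ t =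
      (B ^ t).submatrix Subtype.val Subtype.val := by
  induction t with
  | zero => simp [submatrix_one _ Subtype.val_injective]
  | succ t ih =>
    rw [pow_succ', ih, pow_succ']
    ext ⟨i, hi⟩ ⟨j, hj⟩
    simp only [mul_apply, submatrix_apply]
    rw [← Finset.sum_subtype (Finset.univ.filter fun a => m a = ℓ) (by simp)
      (fun a => B i a * (B ^ t) a j)]
    exact Finset.sum_filter_of_ne fun a _ h => (hB i a (left_ne_zero_of_mul h)).symm.trans hi

/-- Cyclic block maps exist for `gcd h L` blocks. -/
theorem IsIrreducible.exists_isCyclicBlockMap (hA : A.IsIrreducible) {L r : ℕ} (hL : 0 < L)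
    (hr : r = Nat.gcd (imprimitivityIndex A) L) : ∃ m, IsCyclicBlockMap A L r m := by
  have hr0 : 0 < r := hr ▸ Nat.gcd_pos_of_pos_right _ hL
  obtain ⟨τ, hτ⟩ := hA.exists_phase
  have hτr : ∀ i j, 0 < A i j → τ j ≡ τ i + 1 [MOD r] := fun i j h =>
    (hτ i j h).of_dvd (hr ▸ Nat.gcd_dvd_left _ _)
  have hblock : ∀ i j, (A ^ L) i j ≠ 0 → τ i ≡ τ j [MOD r] := fun i j h => by
    have h1 := modEq_add_of_pow_apply_pos hA.nonneg hτr
      ((pow_apply_nonneg hA.nonneg L i j).lt_of_ne' h)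
    have h2 : L ≡ 0 [MOD r] := Nat.modEq_zero_iff_dvd.2 (hr ▸ Nat.gcd_dvd_right _ _)
    exact (h1.trans (h2.add_left (τ i))).symm
  have hblock' : ∀ i j, (A ^ L) i j ≠ 0 →
      (⟨τ i % r, Nat.mod_lt _ hr0⟩ : Fin r) = ⟨τ j % r, Nat.mod_lt _ hr0⟩ :=
    fun i j h => Fin.ext (hblock i j h)
  refine ⟨fun i => ⟨τ i % r, Nat.mod_lt _ hr0⟩, ?_, ?_, hblock', ?_⟩
  · intro ℓ
    -- Starting at index `0`, a walk of length `ℓ + τ 0 * (r - 1)` ends in block `ℓ`.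
    obtain ⟨j, hj⟩ := hA.exists_pow_apply_pos_of_length (ℓ + τ 0 * (r - 1)) 0
    have h := modEq_add_of_pow_apply_pos hA.nonneg hτr hj
    refine ⟨j, Fin.ext ?_⟩
    have h' : τ 0 + (ℓ + τ 0 * (r - 1)) = ℓ + r * τ 0 := by
      obtain ⟨s, rfl⟩ : ∃ s, r = s + 1 := ⟨r - 1, by omega⟩
      rw [Nat.add_sub_cancel]; ring
    rw [h', Nat.ModEq, Nat.add_mul_mod_self_left, Nat.mod_eq_of_lt ℓ.2] at h
    exact h
  · intro i j h
    have := hτr i j ((hA.nonneg i j).lt_of_ne' h)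
    show τ j % r = (τ i % r + 1) % r
    rw [Nat.mod_add_mod]
    exact this
  · intro ℓ
    have hsub : ∀ i j : {i // (⟨τ i % r, Nat.mod_lt _ hr0⟩ : Fin r) = ℓ},
        0 ≤ (A ^ L).submatrix Subtype.val Subtype.val i j :=
      fun i j => pow_apply_nonneg hA.nonneg L i.1 j.1
    refine (isIrreducible_iff_exists_pow_pos hsub).2 ?_
    rintro ⟨i, hi⟩ ⟨j, hj⟩
    obtain ⟨t, ht, hpos⟩ := hA.exists_pow_pow_apply_pos hL (τ := τ) (i := i) (j := j) (hr ▸ hτr)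
      (by rw [← hr]; exact congrArg Fin.val (hi.trans hj.symm))
    exact ⟨t, ht, by rw [submatrix_pow_of_blockDiagonal hblock']; exact hpos⟩

/-- The power `A ^ L` is irreducible exactly when `L` is prime to the index of imprimitivity. -/
theorem IsIrreducible.not_isIrreducible_pow_iff (hA : A.IsIrreducible) {L r : ℕ} (hL : 0 < L)
    (hr : r = Nat.gcd (imprimitivityIndex A) L) : ¬ (A ^ L).IsIrreducible ↔ 1 < r := by
  have hr0 : 0 < r := hr ▸ Nat.gcd_pos_of_pos_right _ hL
  have hnn : ∀ i j, 0 ≤ (A ^ L) i j := pow_apply_nonneg hA.nonneg L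
  constructor
  · contrapose
    intro h1
    obtain rfl : r = 1 := by omega
    rw [isIrreducible_iff_exists_pow_pos hnn]
    intro i j
    exact hA.exists_pow_pow_apply_pos hL (τ := fun _ => 0) (hr ▸ fun _ _ _ => Nat.modEq_one) rfl
  · intro h1 hirr
    obtain ⟨m, hm⟩ := hA.exists_isCyclicBlockMap hL hr
    obtain ⟨i, hi⟩ := hm.surjective ⟨0, hr0⟩
    obtain ⟨j, hj⟩ := hm.surjective ⟨1, h1⟩
    obtain ⟨t, -, ht⟩ := hirr.exists_pow_apply_pos i j
    have := eq_of_pow_apply_ne_zero hm.blockDiagonal ht.ne'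
    simp [hi, hj] at this

end Matrix

/-! ### Sharpness of the bounds -/

namespace Matrix

section

variable {ι : Type*} [Fintype ι] [DecidableEq ι] {A : Matrix ι ι ℝ}

lemma IsIrreducible.pow_mulVec_pos (hA : A.IsIrreducible) {x : ι → ℝ} (hx : ∀ i, 0 < x i)
    (t : ℕ) (i : ι) : 0 < ((A ^ t) *ᵥ x) i := by
  obtain ⟨j, hj⟩ := hA.exists_pow_apply_pos_of_length t i
  exact Finset.sum_pos' (fun a _ => mul_nonneg (pow_apply_nonneg hA.nonneg t i a) (hx a).le)
    ⟨j, Finset.mem_univ _, mul_pos hj (hx j)⟩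

/-- Averaged with the weights `y i * (A ^ M) i j * x j * x i / (A ^ M x) i`, the quotients
`(A ^ M x) i * (A ^ N x) j / (x i * x j)` have mean `ρ ^ (M + N)`. -/
lemma IsIrreducible.sum_weight_mul_sub_eq_zero (hA : A.IsIrreducible) {x y : ι → ℝ} {ρ : ℝ}
    (hx : ∀ i, 0 < x i) (hyA : y ᵥ* A = ρ • y) (M N : ℕ) :
    ∑ i, ∑ j, y i * (A ^ M) i j * x j * (x i / ((A ^ M) *ᵥ x) i) *
      (((A ^ M) *ᵥ x) i * ((A ^ N) *ᵥ x) j / (x i * x j) - ρ ^ (M + N)) = 0 := by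
  have hR := hA.pow_mulVec_pos hx M
  have h1 : ∀ i, ∑ j, y i * (A ^ M) i j * x j * (x i / ((A ^ M) *ᵥ x) i) *
      (((A ^ M) *ᵥ x) i * ((A ^ N) *ᵥ x) j / (x i * x j)) = y i * ((A ^ (M + N)) *ᵥ x) i := by
    intro i
    have h3 : ((A ^ M) *ᵥ ((A ^ N) *ᵥ x)) i = ∑ j, (A ^ M) i j * ((A ^ N) *ᵥ x) j := rfl
    rw [pow_add, ← mulVec_mulVec, h3, Finset.mul_sum]
    refine Finset.sum_congr rfl fun j _ => ?_
    have := (hR i).ne'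
    have := (hx i).ne'
    have := (hx j).ne'
    field_simp
  have h2 : ∀ i, ∑ j, y i * (A ^ M) i j * x j * (x i / ((A ^ M) *ᵥ x) i) * ρ ^ (M + N) =
      ρ ^ (M + N) * (y i * x i) := by
    intro i
    have h3 : ∑ j, (A ^ M) i j * x j = ((A ^ M) *ᵥ x) i := rfl
    calc _ = (∑ j, (A ^ M) i j * x j) * (y i * (x i / ((A ^ M) *ᵥ x) i) * ρ ^ (M + N)) := by
          rw [Finset.sum_mul]
          exact Finset.sum_congr rfl fun j _ => by ring
      _ = _ := by
          rw [h3]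
          have := (hR i).ne'
          field_simp
  simp only [mul_sub, Finset.sum_sub_distrib, h1, h2, ← Finset.mul_sum]
  exact sub_eq_zero.2 (dotProduct_pow_mulVec hyA (M + N) x)

/-- If all the quotients lie on one side of their weighted mean `ρ ^ (M + N)`, they equal it. The
sign of `ε` selects the side. -/
lemma IsIrreducible.quotient_eq_of_le (hA : A.IsIrreducible) {x y : ι → ℝ} {ρ : ℝ}
    (hx : ∀ i, 0 < x i) (hy : ∀ i, 0 < y i) (hyA : y ᵥ* A = ρ • y) {M N : ℕ} {ε : ℝ} (hε : ε ≠ 0)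
    (h : ∀ i j, 0 < (A ^ M) i j → 0 ≤
      ε * (((A ^ M) *ᵥ x) i * ((A ^ N) *ᵥ x) j / (x i * x j) - ρ ^ (M + N)))
    {i j : ι} (hij : 0 < (A ^ M) i j) :
    ((A ^ M) *ᵥ x) i * ((A ^ N) *ᵥ x) j / (x i * x j) = ρ ^ (M + N) := by
  have hR := hA.pow_mulVec_pos hx M
  have hsum := congrArg (ε * ·) (hA.sum_weight_mul_sub_eq_zero hx hyA M N)
  simp only [Finset.mul_sum, mul_zero, mul_left_comm ε] at hsum
  have hterm : ∀ a b, 0 ≤ y a * (A ^ M) a b * x b * (x a / ((A ^ M) *ᵥ x) a) *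
      (ε * (((A ^ M) *ᵥ x) a * ((A ^ N) *ᵥ x) b / (x a * x b) - ρ ^ (M + N))) := by
    intro a b
    rcases (pow_apply_nonneg hA.nonneg M a b).eq_or_lt with h0 | h0
    · simp [← h0]
    · have := hy a
      have := hx b
      have := hx a
      have := hR a
      exact mul_nonneg (by positivity) (h a b h0)
  rw [Finset.sum_eq_zero_iff_of_nonneg
    fun a _ => Finset.sum_nonneg fun b _ => hterm a b] at hsum
  have hi := hsum i (Finset.mem_univ i)
  rw [Finset.sum_eq_zero_iff_of_nonneg fun b _ => hterm i b] at hi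
  have hj := hi j (Finset.mem_univ j)
  have hw : 0 < y i * (A ^ M) i j * x j * (x i / ((A ^ M) *ᵥ x) i) := by
    have := hy i
    have := hx j
    have := hx i
    have := hR i
    positivity
  rw [mul_eq_zero, or_iff_right hw.ne', mul_eq_zero, or_iff_right hε, sub_eq_zero] at hj
  exact hj

/-- If all the quotients have the same value `v`, then `x` is an eigenvector of `A ^ (M + N)`. -/
lemma IsIrreducible.pow_mulVec_eq_of_quotient_eq (hA : A.IsIrreducible) {x : ι → ℝ}
    (hx : ∀ i, 0 < x i) {M N : ℕ} {v : ℝ}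
    (h : ∀ i j, 0 < (A ^ M) i j → ((A ^ M) *ᵥ x) i * ((A ^ N) *ᵥ x) j / (x i * x j) = v) :
    (A ^ (M + N)) *ᵥ x = v • x := by
  have hR := hA.pow_mulVec_pos hx M
  ext i
  have h3 : ∑ j, (A ^ M) i j * x j = ((A ^ M) *ᵥ x) i := rfl
  rw [pow_add, ← mulVec_mulVec, Pi.smul_apply, smul_eq_mul]
  calc ∑ j, (A ^ M) i j * ((A ^ N) *ᵥ x) j
      = ∑ j, (A ^ M) i j * x j * (v * x i / ((A ^ M) *ᵥ x) i) := by
        refine Finset.sum_congr rfl fun j _ => ?_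
        rcases (pow_apply_nonneg hA.nonneg M i j).eq_or_lt with h0 | h0
        · simp [← h0]
        · have := (hR i).ne'
          have := (hx i).ne'
          have := (hx j).ne'
          rw [← h i j h0]
          field_simp
    _ = v * x i := by
        rw [← Finset.sum_mul, h3]
        have := (hR i).ne'
        field_simp

/-- The maximum principle: if `B` is nonnegative and block diagonal with irreducible blocks, then
two eigenvectors for the same eigenvalue, the first of them positive, are proportional on each
block. -/
lemma exists_eq_mul_of_blockDiagonal {κ : Type*} [DecidableEq κ] {B : Matrix ι ι ℝ}
    (hB0 : ∀ i j, 0 ≤ B i j) {m : ι → κ} (hm : Function.Surjective m)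
    (hB : ∀ i j, B i j ≠ 0 → m i = m j)
    (hirr : ∀ ℓ, (B.submatrix (Subtype.val : {i // m i = ℓ} → ι)
      (Subtype.val : {i // m i = ℓ} → ι)).IsIrreducible)
    {x w : ι → ℝ} {v : ℝ} (hx : ∀ i, 0 < x i) (hBx : B *ᵥ x = v • x) (hBw : B *ᵥ w = v • w) :
    ∃ c : κ → ℝ, ∀ i, w i = c (m i) * x i := by
  have key : ∀ ℓ, ∃ c, ∀ i, m i = ℓ → w i = c * x i := by
    intro ℓ
    obtain ⟨i₀, hi₀⟩ := hm ℓ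
    obtain ⟨i, hi, hmin⟩ := Finset.exists_min_image (Finset.univ.filter fun a => m a = ℓ)
      (fun a => w a / x a) ⟨i₀, by simp [hi₀]⟩
    simp only [Finset.mem_filter, Finset.mem_univ, true_and] at hi hmin
    -- `u = w - c x` is a nonnegative eigenvector on the block, and it vanishes at `i`.
    set c := w i / x i
    have hu : ∀ a, m a = ℓ → 0 ≤ w a - c * x a := fun a ha =>
      sub_nonneg.2 ((le_div_iff₀ (hx a)).1 (hmin a ha))
    have hui : w i - c * x i = 0 := by rw [div_mul_cancel₀ _ (hx i).ne', sub_self]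
    have hBu : B *ᵥ (w - c • x) = v • (w - c • x) := by
      rw [mulVec_sub, mulVec_smul, hBx, hBw, smul_sub, smul_comm]
    refine ⟨c, fun j hj => ?_⟩
    obtain ⟨t, -, ht⟩ := (hirr ℓ).exists_pow_apply_pos ⟨i, hi⟩ ⟨j, hj⟩
    rw [submatrix_pow_of_blockDiagonal hB] at ht
    have hsum : ∑ a, (B ^ t) i a * (w a - c * x a) = 0 := by
      have := congrFun (pow_mulVec_of_mulVec_eq_smul hBu t) i
      simp only [Pi.smul_apply, Pi.sub_apply, smul_eq_mul, hui, mul_zero] at this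
      exact this
    rw [Finset.sum_eq_zero_iff_of_nonneg] at hsum
    · have := hsum j (Finset.mem_univ j)
      rw [mul_eq_zero, or_iff_right (show (B ^ t) i j ≠ 0 from ht.ne')] at this
      linarith
    · intro a _
      by_cases h0 : (B ^ t) i a = 0
      · simp [h0]
      · exact mul_nonneg (pow_apply_nonneg hB0 t i a)
          (hu a ((eq_of_pow_apply_ne_zero hB h0).symm.trans hi))
  choose c hc using key
  exact ⟨c, fun i => hc _ i rfl⟩

/-- If `A x` is `c (m i) * x i` with `m` advancing cyclically, then `A ^ t x` multiplies `x i` by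
the product of `t` consecutive values of `c`. -/
lemma pow_mulVec_eq_prod_mul (hA : ∀ i j, 0 ≤ A i j) {r : ℕ} [NeZero r] {m : ι → Fin r}
    (hm : ∀ i j, 0 < A i j → m j = m i + 1) {x : ι → ℝ} {c : Fin r → ℝ}
    (hc : ∀ i, (A *ᵥ x) i = c (m i) * x i) (t : ℕ) (i : ι) :
    ((A ^ t) *ᵥ x) i = (∏ s ∈ Finset.range t, c (m i + Fin.ofNat r s)) * x i := by
  induction t generalizing i with
  | zero => simp
  | succ t ih =>
    have h3 : ∑ j, A i j * x j = (A *ᵥ x) i := rfl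
    have hstep : ∀ s : ℕ, m i + 1 + Fin.ofNat r s = m i + Fin.ofNat r (s + 1) := by
      intro s
      ext
      simp [Fin.val_add, add_assoc, add_comm 1]
    rw [pow_succ', ← mulVec_mulVec, Finset.prod_range_succ']
    calc ∑ j, A i j * ((A ^ t) *ᵥ x) j
        = ∑ j, (∏ s ∈ Finset.range t, c (m i + Fin.ofNat r (s + 1))) * (A i j * x j) := by
          refine Finset.sum_congr rfl fun j _ => ?_
          rcases (hA i j).eq_or_lt with h0 | h0
          · simp [← h0]
          · rw [ih, hm i j h0]
            simp only [hstep]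
            ring
      _ = _ := by
          rw [← Finset.mul_sum, h3, hc]
          simp [mul_assoc]

lemma prod_range_shift {r : ℕ} [NeZero r] (c : Fin r → ℝ) (a : Fin r) :
    ∏ s ∈ Finset.range r, c (a + Fin.ofNat r s) = ∏ ℓ, c ℓ := by
  rw [Finset.prod_range, ← Equiv.prod_comp (Equiv.addLeft a) c]
  refine Finset.prod_congr rfl fun s _ => ?_
  simp

end

variable {n : ℕ} {A : Matrix (Fin n) (Fin n) ℝ}

lemma rowSum_eq_mulVec_one (B : Matrix (Fin n) (Fin n) ℝ) (i : Fin n) :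
    rowSum B i = (B *ᵥ 1) i := by
  simp [rowSum, mulVec, dotProduct]

lemma rowSum_pow_add (A : Matrix (Fin n) (Fin n) ℝ) (k t : ℕ) (i : Fin n) :
    rowSum (A ^ (k + t)) i = ((A ^ t) *ᵥ rowSum (A ^ k)) i := by
  rw [rowSum_eq_mulVec_one, add_comm, pow_add, ← mulVec_mulVec]
  congr 2
  ext j
  rw [rowSum_eq_mulVec_one]

lemma IsIrreducible.rowSum_pow_pos (hA : A.IsIrreducible) (k : ℕ) (i : Fin n) :
    0 < rowSum (A ^ k) i := by
  rw [rowSum_eq_mulVec_one]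
  exact hA.pow_mulVec_pos (fun _ => one_pos) k i

/-- Either bound is attained by the spectral radius only if all the bounding quotients agree. -/
theorem IsIrreducible.isLeast_and_isGreatest_boundValues_iff [NeZero n] (hA : A.IsIrreducible)
    {M N : ℕ} (hM : 0 < M) (k : ℕ) :
    (IsLeast (boundValues A M N k) (specRad A) ↔ ∀ i j, 0 < (A ^ M) i j →
      ((A ^ M) *ᵥ rowSum (A ^ k)) i * ((A ^ N) *ᵥ rowSum (A ^ k)) j /
        (rowSum (A ^ k) i * rowSum (A ^ k) j) = specRad A ^ (M + N)) ∧
    (IsGreatest (boundValues A M N k) (specRad A) ↔ ∀ i j, 0 < (A ^ M) i j →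
      ((A ^ M) *ᵥ rowSum (A ^ k)) i * ((A ^ N) *ᵥ rowSum (A ^ k)) j /
        (rowSum (A ^ k) i * rowSum (A ^ k) j) = specRad A ^ (M + N)) := by
  obtain ⟨hρ, -, y, hy, hyA⟩ := hA.exists_specRad_eigenvectors
  have hx := hA.rowSum_pow_pos k
  have hp : (0 : ℝ) < ((M + N : ℕ) : ℝ) := by
    rw [Nat.cast_pos]
    omega
  set ρ := specRad A
  set x : Fin n → ℝ := rowSum (A ^ k)
  set F : Fin n → Fin n → ℝ := fun i j =>
    ((A ^ M) *ᵥ x) i * ((A ^ N) *ᵥ x) j / (x i * x j) with hF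
  have hF0 : ∀ i j, 0 ≤ F i j := fun i j =>
    div_nonneg (mul_nonneg (hA.pow_mulVec_pos hx M i).le (hA.pow_mulVec_pos hx N j).le)
      (mul_nonneg (hx i).le (hx j).le)
  have hbound : boundValues A M N k =
      {v | ∃ i j, 0 < (A ^ M) i j ∧ v = F i j ^ (((M + N : ℕ) : ℝ)⁻¹)} := by
    simp only [boundValues, rowSum_pow_add, one_div]
    rfl
  have hle : ∀ i j, ρ ≤ F i j ^ (((M + N : ℕ) : ℝ)⁻¹) ↔ ρ ^ (M + N) ≤ F i j := fun i j => by
    rw [Real.le_rpow_inv_iff_of_pos hρ.le (hF0 i j) hp, Real.rpow_natCast]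
  have hge : ∀ i j, F i j ^ (((M + N : ℕ) : ℝ)⁻¹) ≤ ρ ↔ F i j ≤ ρ ^ (M + N) := fun i j => by
    rw [Real.rpow_inv_le_iff_of_pos (hF0 i j) hρ.le hp, Real.rpow_natCast]
  -- The set of bounding values is nonempty, so equality of all quotients does attain the bound.
  have hmem : (∀ i j, 0 < (A ^ M) i j → F i j = ρ ^ (M + N)) → ρ ∈ boundValues A M N k := by
    intro h
    obtain ⟨j, hj⟩ := hA.exists_pow_apply_pos_of_length M 0
    rw [hbound]
    exact ⟨0, j, hj, le_antisymm ((hle 0 j).2 (h 0 j hj).ge) ((hge 0 j).2 (h 0 j hj).le)⟩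
  refine ⟨⟨fun h i j hij => ?_, fun h => ⟨hmem h, ?_⟩⟩,
    ⟨fun h i j hij => ?_, fun h => ⟨hmem h, ?_⟩⟩⟩
  · refine hA.quotient_eq_of_le hx hy hyA one_ne_zero (fun a b hab => ?_) hij
    rw [one_mul, sub_nonneg]
    exact (hle a b).1 (h.2 (hbound ▸ ⟨a, b, hab, rfl⟩))
  · rw [hbound]
    rintro _ ⟨i, j, hij, rfl⟩
    exact (hle i j).2 (h i j hij).ge
  · refine hA.quotient_eq_of_le hx hy hyA (neg_ne_zero.2 one_ne_zero) (fun a b hab => ?_) hij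
    rw [neg_one_mul, neg_sub, sub_nonneg]
    exact (hge a b).1 (h.2 (hbound ▸ ⟨a, b, hab, rfl⟩))
  · rw [hbound]
    rintro _ ⟨i, j, hij, rfl⟩
    exact (hge i j).2 (h i j hij).le

lemma _root_.IsCyclicBlockMap.eq_add_one {L r : ℕ} [NeZero r] {m : Fin n → Fin r}
    (hm : IsCyclicBlockMap A L r m) {i j : Fin n} (h : 0 < A i j) : m j = m i + 1 := by
  ext
  rw [hm.superdiagonal i j h.ne', Fin.val_add, Fin.val_one', Nat.add_mod_mod]

lemma _root_.IsCyclicBlockMap.eq_add_of_pow_apply_pos (hA : ∀ i j, 0 ≤ A i j) {L r : ℕ} [NeZero r]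
    {m : Fin n → Fin r} (hm : IsCyclicBlockMap A L r m) {t : ℕ} {i j : Fin n}
    (h : 0 < (A ^ t) i j) : m j = m i + Fin.ofNat r t := by
  have := modEq_add_of_pow_apply_pos (r := r) (m := fun i => (m i : ℕ)) hA (fun a b hab => by
    rw [hm.superdiagonal a b hab.ne']
    exact Nat.mod_modEq _ _) h
  ext
  rw [Fin.val_add, Fin.val_ofNat, Nat.add_mod_mod, ← this, Nat.mod_eq_of_lt (m j).2]

/-- Constant growth on the blocks makes the row sums an eigenvector of `A ^ r`, which determines
the spectral radius. -/
theorem IsIrreducible.specRad_pow_eq_prod [NeZero n] (hA : A.IsIrreducible) {L r : ℕ} [NeZero r]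
    {m : Fin n → Fin r} (hm : IsCyclicBlockMap A L r m) {x : Fin n → ℝ} (hx : ∀ i, 0 < x i)
    {c : Fin r → ℝ} (hc : ∀ i, (A *ᵥ x) i = c (m i) * x i) : specRad A ^ r = ∏ ℓ, c ℓ := by
  obtain ⟨hρ, -, y, hy, hyA⟩ := hA.exists_specRad_eigenvectors
  have h1 : (A ^ r) *ᵥ x = (∏ ℓ, c ℓ) • x := by
    ext i
    rw [pow_mulVec_eq_prod_mul hA.nonneg (fun i j h => hm.eq_add_one h) hc, prod_range_shift]
    rfl
  have h2 := dotProduct_pow_mulVec hyA r x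
  rw [h1, dotProduct_smul, smul_eq_mul] at h2
  exact (mul_right_cancel₀ (Finset.sum_pos (fun i _ => mul_pos (hy i) (hx i))
    Finset.univ_nonempty).ne' h2).symm

/-- All the quotients equal `ρ ^ (M + N)` exactly when `A x / x` is constant on each block: one
direction is the maximum principle, applied to the eigenvectors `x` and `A x` of `A ^ (M + N)`. -/
theorem IsIrreducible.quotient_eq_iff [NeZero n] (hA : A.IsIrreducible) {M N r : ℕ} [NeZero r]
    (hr : r ∣ M + N) {m : Fin n → Fin r} (hm : IsCyclicBlockMap A (M + N) r m) {x : Fin n → ℝ}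
    (hx : ∀ i, 0 < x i) :
    (∀ i j, 0 < (A ^ M) i j →
      ((A ^ M) *ᵥ x) i * ((A ^ N) *ᵥ x) j / (x i * x j) = specRad A ^ (M + N)) ↔
    ∃ c : Fin r → ℝ, ∀ i, (A *ᵥ x) i = c (m i) * x i := by
  constructor
  · intro h
    have hAx := hA.pow_mulVec_eq_of_quotient_eq hx h
    refine exists_eq_mul_of_blockDiagonal (pow_apply_nonneg hA.nonneg (M + N)) hm.surjective
      hm.blockDiagonal hm.irreducible_block hx hAx ?_
    rw [mulVec_mulVec, ← pow_succ, pow_succ', ← mulVec_mulVec, hAx, mulVec_smul]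
  · rintro ⟨c, hc⟩ i j hij
    have hρ := hA.specRad_pow_eq_prod hm hx hc
    have hpow := fun t i => pow_mulVec_eq_prod_mul hA.nonneg (fun i j h => hm.eq_add_one h) hc t i
    have hAr : (A ^ r) *ᵥ x = specRad A ^ r • x := by
      ext i
      rw [hpow, prod_range_shift, hρ]
      rfl
    have hAL : ((A ^ (M + N)) *ᵥ x) i = specRad A ^ (M + N) * x i := by
      obtain ⟨q, hq⟩ := hr
      rw [hq, pow_mul, pow_mulVec_of_mulVec_eq_smul hAr, pow_mul]
      rfl
    have hshift : ∀ s : ℕ, m i + Fin.ofNat r M + Fin.ofNat r s = m i + Fin.ofNat r (M + s) := by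
      intro s
      ext
      simp [Fin.val_add, add_assoc]
    -- A walk of length `M` leads to the block where the product for `A ^ N` has to start.
    rw [hpow, Finset.prod_range_add] at hAL
    rw [hpow, hpow, hm.eq_add_of_pow_apply_pos hA.nonneg hij]
    simp only [hshift]
    rw [← mul_right_cancel₀ (hx i).ne' hAL]
    have := (hx i).ne'
    have := (hx j).ne'
    field_simp

end Matrix

theorem mainTheorem6 {n : ℕ} (hn : 0 < n) (A : Matrix (Fin n) (Fin n) ℝ)
    (hA : A.IsIrreducible) (hrow : ∀ i, rowSum A i ≠ 0)
    (M N k : ℕ) (hM : 0 < M) (r : ℕ) (hr : r = Nat.gcd (imprimitivityIndex A) (M + N)) :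
    (¬ (A ^ (M + N)).IsIrreducible ↔ 1 < r) ∧
    (1 < r →
      (∃ m : Fin n → Fin r, IsCyclicBlockMap A (M + N) r m) ∧
      ∀ m : Fin n → Fin r, IsCyclicBlockMap A (M + N) r m →
        (IsLeast (boundValues A M N k) (specRad A) ↔
          ∃ c : Fin r → ℝ, ∀ i, rowSum (A ^ (k + 1)) i / rowSum (A ^ k) i = c (m i)) ∧
        (IsGreatest (boundValues A M N k) (specRad A) ↔
          ∃ c : Fin r → ℝ, ∀ i, rowSum (A ^ (k + 1)) i / rowSum (A ^ k) i = c (m i)) ∧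
        ∀ c : Fin r → ℝ,
          (∀ i, rowSum (A ^ (k + 1)) i / rowSum (A ^ k) i = c (m i)) →
            specRad A ^ r = ∏ ℓ, c ℓ) := by
  have : NeZero n := ⟨hn.ne'⟩
  have hL : 0 < M + N := Nat.add_pos_left hM N
  refine ⟨hA.not_isIrreducible_pow_iff hL hr, fun h1 =>
    ⟨hA.exists_isCyclicBlockMap hL hr, fun m hm => ?_⟩⟩
  have : NeZero r := ⟨by omega⟩
  have hx := hA.rowSum_pow_pos k
  have hratio : ∀ (c : Fin r → ℝ) (i : Fin n), rowSum (A ^ (k + 1)) i / rowSum (A ^ k) i = c (m i) ↔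
      (A.mulVec (rowSum (A ^ k))) i = c (m i) * rowSum (A ^ k) i := fun c i => by
    rw [Matrix.rowSum_pow_add, pow_one, div_eq_iff (hx i).ne']
  simp only [hratio]
  obtain ⟨hleast, hgreatest⟩ := hA.isLeast_and_isGreatest_boundValues_iff (N := N) hM k
  have hquot := hA.quotient_eq_iff (hr ▸ Nat.gcd_dvd_right _ _) hm hx
  exact ⟨hleast.trans hquot, hgreatest.trans hquot,
    fun c hc => hA.specRad_pow_eq_prod hm hx hc⟩
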